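/- Let $R$ be a Henselian Cohen–Macaulay (Noetherian commutative) local ring with maximal ideal $\mathfrak m$ and residue field $k=R/\mathfrak m$. Assume that $R$ has a canonical module and that $R$ is an isolated singularity, i.e. $R_{\mathfrak p}$ is regular for every prime $\mathfrak p\neq\mathfrak m$. A finitely generated $R$-module $M$ is called maximal Cohen–Macaulay (MCM) if $\mathrm{Ext}^i_R(k,M)=0$ for all $i<\dim R$ (so the zero module is included). Let $\mathcal C$ be the full subcategory of MCM modules in the category of $R$-modules, and let $\widetilde{\mathcal C}$ be the abelian category of contravariant additive functors from $\mathcal C$ to abelian groups. Let $\widehat{\mathcal C}_0\subset\widetilde{\mathcal C}$ be the full subcategory of those $F$ with $F(R)\cong 0$ which are finitely presented, i.e. which fit into an exact sequence $\mathrm{Hom}_{\mathcal C}(-,M)\to \mathrm{Hom}_{\mathcal C}(-,M')\to F\to 0$ with $M,M'\in\mathcal C$. For an indecomposable $M\in\mathcal C$ put $S_M=\mathrm{Hom}_{\mathcal C}(-,M)/\mathrm{rad}(\mathcal C)(-,M)$, where $\mathrm{rad}(\mathcal C)(X,M)$ consists of those $f:X\to M$ such that $fg$ lies in the Jacobson radical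 of $\mathrm{End}_R(M)$ for all $g:M\to X$. Theorem. Suppose $R$ is of finite Cohen–Macaulay type, i.e. there are only finitely many isomorphism classes of indecomposable MCM $R$-modules. Then every functor $F$ in $\widehat{\mathcal C}_0$ admits a finite filtration $$0=F_0\subset F_1\subset\cdots\subset F_{n-1}\subset F_n=F$$ with all $F_i$ in $\widehat{\mathcal C}_0$ such that, for each $i=1,\dots,n$, the quotient $F_i/F_{i-1}$ is simple in $\widetilde{\mathcal C}$ and isomorphic to $S_M$ for some indecomposable MCM module $M\not\cong R$. -/

import Mathlib

open CategoryTheory CategoryTheory.Limits Opposite IsLocalRing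

universe u

/-! ### Additive functors form an abelian category

The instances below, with `Abelian P.FullSubcategory` from Mathlib, make `A ⥤+ B` abelian; kernels
and cokernels are those of the category of all functors, i.e. they are computed pointwise. -/

section AdditiveFunctors

variable {A : Type*} [Category A] [Preadditive A] {B : Type*} [Category B] [Abelian B]

instance additiveFunctor_closedSub :
    (additiveFunctor A B).IsClosedUnderSubobjects where
  prop_of_mono {F G} i _ hG := by
    have : G.Additive := hG
    refine (additiveFunctor_iff F).mpr ⟨fun {X Y f g} => ?_⟩
    rw [← cancel_mono (i.app Y)]
    simp [Functor.map_add]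

instance additiveFunctor_closedQuot :
    (additiveFunctor A B).IsClosedUnderQuotients where
  prop_of_epi {F G} p _ hF := by
    have : F.Additive := hF
    refine (additiveFunctor_iff G).mpr ⟨fun {X Y f g} => ?_⟩
    rw [← cancel_epi (p.app X), ← p.naturality]
    simp [Functor.map_add]

instance additiveFunctor_containsZero : (additiveFunctor A B).ContainsZero where
  exists_zero := by
    obtain ⟨Z, hZ⟩ := HasZeroObject.zero (C := A ⥤ B)
    exact ⟨Z, hZ, (additiveFunctor_iff Z).mpr ⟨fun {_ _ _ _} => (hZ.obj _).eq_of_src _ _⟩⟩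

instance additiveFunctor_closedProducts :
    (additiveFunctor A B).IsClosedUnderFiniteProducts := by
  refine ⟨fun J _ => ⟨?_⟩⟩
  rintro F ⟨h⟩
  have (j : Discrete J) : (h.diag.obj j).Additive := h.prop_diag_obj j
  refine (additiveFunctor_iff F).mpr ⟨fun {X Y f g} => ?_⟩
  apply (isLimitOfPreserves ((evaluation A B).obj Y) h.isLimit).hom_ext
  intro j
  have e (k : X ⟶ Y) := (h.π.app j).naturality k
  simp only [Functor.const_obj_obj] at e
  simp [e, Functor.map_add]

end AdditiveFunctors

/-! ### The radical of a preadditive category, and the functors `S_M` -/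

section Radical

variable {A : Type*} [Category A] [Preadditive A]

/-- The maps `X ⟶ Y` in the Jacobson radical of the category: those `f` such that for all
`g : Y ⟶ X` the composite `Y ⟶ X ⟶ Y` lies in the Jacobson radical of the ring `End Y`. -/
def radHom (X Y : A) : AddSubgroup (X ⟶ Y) where
  carrier := {f | ∀ g : Y ⟶ X, End.of (g ≫ f) ∈ Ring.jacobson (End Y)}
  zero_mem' g := by
    rw [comp_zero]
    exact (Ring.jacobson (End Y)).zero_mem
  add_mem' {a b} ha hb g := by
    rw [Preadditive.comp_add]
    exact (Ring.jacobson (End Y)).add_mem (ha g) (hb g)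
  neg_mem' {a} ha g := by
    rw [Preadditive.comp_neg]
    exact (Ring.jacobson (End Y)).neg_mem (ha g)

lemma radHom_precomp {X X' : A} (Y : A) (f : X' ⟶ X) :
    radHom X Y ≤ (radHom X' Y).comap (Preadditive.leftComp Y f) := fun a ha g => by
  have := ha (g ≫ f)
  rw [Category.assoc] at this
  exact this

end Radical

section Simples

universe v w

variable {A : Type w} [Category.{v} A] [Preadditive A]

/-- The functor `S_M = Hom(-, M) / rad(-, M)`. -/
def simpleFunctor (M : A) : Aᵒᵖ ⥤+ AddCommGrpCat.{v} where
  obj :=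
    { obj := fun N => AddCommGrpCat.of ((N.unop ⟶ M) ⧸ radHom N.unop M)
      map := fun {N N'} f => AddCommGrpCat.ofHom
        (QuotientAddGroup.map _ _ (Preadditive.leftComp M f.unop) (radHom_precomp M f.unop))
      map_id := fun N => by
        ext x
        simp [Preadditive.leftComp]
      map_comp := fun f g => by
        ext x
        simp [Preadditive.leftComp] }
  property := (additiveFunctor_iff _).mpr ⟨fun {N N' f g} => by
    ext x
    simp [Preadditive.leftComp]⟩

/-- The Yoneda embedding `M ↦ Hom(-, M)` into the category of additive functors. -/
def additiveYoneda : A ⥤ (Aᵒᵖ ⥤+ AddCommGrpCat.{v}) :=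
  (additiveFunctor Aᵒᵖ AddCommGrpCat.{v}).lift preadditiveYoneda
    fun M => (additiveFunctor_iff _).mpr (additive_yonedaObj' M)

/-- `F` is finitely presented: there is an exact sequence
`Hom(-, M) ⟶ Hom(-, M') ⟶ F ⟶ 0` of additive functors. -/
def IsFinPresFunctor (F : Aᵒᵖ ⥤+ AddCommGrpCat.{v}) : Prop :=
  ∃ (M M' : A) (g : additiveYoneda.obj M ⟶ additiveYoneda.obj M')
    (p : additiveYoneda.obj M' ⟶ F) (w : g ≫ p = 0),
    (ShortComplex.mk g p w).Exact ∧ Epi p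

end Simples

/-! ### Maximal Cohen-Macaulay modules -/

section MCM

variable (R : Type u) [CommRing R] [IsLocalRing R]

/-- The residue field as an `R`-module. -/
noncomputable abbrev residueModule : ModuleCat.{u} R := ModuleCat.of R (ResidueField R)

/-- A finitely generated module `M` over a local ring `R` with residue field `k` is maximal
Cohen-Macaulay if `Ext^i(k, M) = 0` for all `i < dim R`.  (The zero module is included.) -/
def isMCM : ObjectProperty (ModuleCat.{u} R) := fun M =>
  Module.Finite R M ∧
    ∀ i : ℕ, (i : WithBot ℕ∞) < ringKrullDim R → Subsingleton (Abelian.Ext (residueModule R) M i)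

/-- The category of maximal Cohen-Macaulay modules. -/
abbrev MCMCat : Type (u + 1) := (isMCM R).FullSubcategory

/-- A Noetherian local ring is Cohen-Macaulay if it is maximal Cohen-Macaulay as a module. -/
class IsCMLocalRing [IsNoetherianRing R] : Prop where
  isMCM_self : isMCM R (ModuleCat.of R R)

/-- `R` as an object of the category of maximal Cohen-Macaulay modules. -/
def MCMCat.self [IsNoetherianRing R] [IsCMLocalRing R] : MCMCat R :=
  ⟨ModuleCat.of R R, IsCMLocalRing.isMCM_self⟩

/-- `R` has a canonical module: a maximal Cohen-Macaulay module `ω` of finite injective dimension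
and of type one, i.e. `Ext^d(k, ω)` is one-dimensional over `k`, where `d = dim R`. -/
def HasCanonicalModule : Prop :=
  ∃ ω : ModuleCat.{u} R, isMCM R ω ∧ (∃ n : ℕ, HasInjectiveDimensionLE ω n) ∧
    ∃ d : ℕ, ringKrullDim R = d ∧
      Nonempty (Abelian.Ext (residueModule R) ω d ≃ₗ[R] ResidueField R)

/-- `R` is an isolated singularity: `R_p` is regular for every nonmaximal prime `p`. -/
def IsIsolatedSingularity : Prop :=
  ∀ (p : Ideal R) [p.IsPrime], p ≠ maximalIdeal R → IsRegularLocalRing (Localization.AtPrime p)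

/-- `R` is of finite Cohen-Macaulay type: there are only finitely many isomorphism classes of
indecomposable maximal Cohen-Macaulay modules. -/
def IsFiniteCMType : Prop :=
  {c : Quotient (isIsomorphicSetoid (MCMCat R)) |
    ∃ M : MCMCat R, Indecomposable M.obj ∧ Quotient.mk _ M = c}.Finite

/-- Contravariant additive functors from maximal Cohen-Macaulay modules to abelian groups. -/
abbrev MCMFunctor : Type (u + 1) := (MCMCat R)ᵒᵖ ⥤+ AddCommGrpCat.{u}

variable {R} in
/-- The functor `F` is finitely presented and `F(R) = 0`. -/
def IsFinPresVanishing [IsNoetherianRing R] [IsCMLocalRing R] (F : MCMFunctor R) : Prop :=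
  IsFinPresFunctor F ∧ IsZero (F.obj.obj (op (MCMCat.self R)))

end MCM

/-!
Let `X₁, …, Xᵣ` be the indecomposable maximal Cohen-Macaulay modules. Every maximal Cohen-Macaulay
module is a direct sum of copies of the `Xⱼ`, so the `Hom(-, Xⱼ)` are projective and separate
morphisms of functors. Hence a subobject of a quotient `F` of `Hom(-, M₀)` is determined by the
submodules of the `Hom(Xⱼ, M₀)` that it induces; these are finite `R`-modules, so `F` is Noetherian.

If `F` is the cokernel of `Hom(-, γ)` and `F(R) = 0`, then `γ : M₁ → M₀` is surjective, and each
`F(X)` has finite length. Indeed, for `f : X → M₀` and `r ∈ 𝔪`, the pullbacks of `γ` along the maps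
`rⁿ f` are extensions of `X` by `ker γ`: they are maximal Cohen-Macaulay with a bounded number of
generators, hence fall into finitely many isomorphism classes. If `g` and `s g` have isomorphic
pullbacks, Miyata's theorem splits a sequence `0 → P(s g) → P(g) × X → X → 0`, which says that `g`
factors through `γ` modulo `s`. Taking `g = rᵐ f` and for `s` arbitrarily large powers of `r`,
Krull's intersection theorem shows that `rᵐ f` factors through `γ`, i.e. vanishes in `F(X)`.

So `F` has a composition series. A simple subquotient `Q` vanishes on `R` and receives a nonzero map
from some `Hom(-, Xⱼ)`; as `R` is Henselian, `End Xⱼ` is local, and therefore the kernel of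
`Hom(-, Xⱼ) → Q` is the radical.
-/

section Henselian

open Polynomial TensorProduct

variable {R : Type u} [CommRing R] [HenselianLocalRing R]

theorem exists_algHom_lift_of_isStandardEtale {T K : Type*} [CommRing T] [Algebra R T]
    [Algebra.IsStandardEtale R T] [Field K] [Algebra R K]
    (hK : Function.Surjective (algebraMap R K)) (φ : T →ₐ[R] K) :
    ∃ s : T →ₐ[R] R, (Algebra.ofId R K).comp s = φ := by
  obtain ⟨P⟩ := Algebra.IsStandardEtale.nonempty_standardEtalePresentation (R := R) (S := T)
  have hmax (r : R) : r ∈ maximalIdeal R ↔ algebraMap R K r = 0 := by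
    rw [← ker_eq_maximalIdeal _ hK, RingHom.mem_ker]
  have := hK.isLocalHom
  obtain ⟨a, ha⟩ := hK (φ P.x)
  have heval {b : R} (hb : algebraMap R K b = φ P.x) (p : R[X]) :
      algebraMap R K (p.eval b) = φ (aeval P.x p) := by
    rw [← aeval_algHom_apply, ← hb, aeval_algebraMap_apply, coe_aeval_eq_eval]
  obtain ⟨b, hb, hba⟩ := HenselianLocalRing.is_henselian P.f P.monic_f a
    (by rw [hmax, heval ha, P.hasMap.1, map_zero])
    (isUnit_of_map_unit (algebraMap R K) _ <| by
      rw [heval ha]; exact P.hasMap.isUnit_derivative_f.map φ)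
  have hbx : algebraMap R K b = φ P.x := by
    rw [← ha, ← sub_eq_zero, ← map_sub, ← hmax]; exact hba
  have hmap : P.HasMap b := by
    refine ⟨by simpa using hb, isUnit_of_map_unit (algebraMap R K) _ ?_⟩
    rw [coe_aeval_eq_eval, heval hbx]
    exact P.hasMap.2.map φ
  refine ⟨(P.lift b hmap).comp P.equivRing.toAlgHom, P.hom_ext ?_⟩
  simpa [Algebra.ofId_apply] using hbx

theorem exists_algHom_lift_of_etale {T K : Type*} [CommRing T] [Algebra R T] [Algebra.Etale R T]
    [Field K] [Algebra R K] (hK : Function.Surjective (algebraMap R K)) (φ : T →ₐ[R] K) :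
    ∃ s : T →ₐ[R] R, (Algebra.ofId R K).comp s = φ := by
  have : (RingHom.ker φ).IsPrime := RingHom.ker_isPrime φ
  obtain ⟨f, hf, _⟩ := Algebra.IsEtaleAt.exists_isStandardEtale (R := R) (RingHom.ker φ)
  obtain ⟨s, hs⟩ := exists_algHom_lift_of_isStandardEtale hK
    (IsLocalization.Away.liftAlgHom (S := Localization.Away f) (f := φ) f
      (by simpa [RingHom.mem_ker] using hf))
  refine ⟨s.comp (IsScalarTower.toAlgHom R T _), ?_⟩
  rw [← AlgHom.comp_assoc, hs]
  ext x
  simp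

theorem exists_algHom_comap_maximalIdeal_eq_of_etale {T : Type*} [CommRing T] [Algebra R T]
    [Algebra.Etale R T] (P : Ideal T) [P.IsPrime] [P.LiesOver (maximalIdeal R)]
    (hP : Function.Bijective (Ideal.ResidueField.mapₐ (maximalIdeal R) P (Algebra.ofId R T)
      (P.over_def (maximalIdeal R)))) :
    ∃ s : T →ₐ[R] R, (maximalIdeal R).comap s = P := by
  have hK : Function.Surjective (algebraMap R P.ResidueField) := by
    intro y
    obtain ⟨z, rfl⟩ := hP.2 y
    obtain ⟨r, rfl⟩ := Ideal.algebraMap_residueField_surjective (maximalIdeal R) z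
    exact ⟨r, by simp⟩
  obtain ⟨s, hs⟩ := exists_algHom_lift_of_etale hK (IsScalarTower.toAlgHom R T P.ResidueField)
  refine ⟨s, Ideal.ext fun x => ?_⟩
  have hx : algebraMap R P.ResidueField (s x) = algebraMap T P.ResidueField x := congr($hs x)
  rw [Ideal.mem_comap, ← ker_eq_maximalIdeal _ hK, RingHom.mem_ker, hx,
    Ideal.algebraMap_residueField_eq_zero]

theorem isLocalRing_of_forall_isIdempotentElem {S : Type*} [CommRing S] [Nontrivial S]
    [Algebra R S] [Module.Finite R S] (hS : ∀ e : S, IsIdempotentElem e → e = 0 ∨ e = 1) :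
    IsLocalRing S := by
  -- An idempotent cuts out a maximal ideal `q` over an étale neighbourhood `T` of the closed point;
  -- as `R` is Henselian, `T` has a section, along which the idempotent descends to `S`.
  obtain ⟨q, hq⟩ := Ideal.exists_maximal S
  have hover (N : Ideal S) [N.IsMaximal] : N.LiesOver (maximalIdeal R) :=
    ⟨(IsLocalRing.eq_maximalIdeal (Ideal.isMaximal_comap_of_isIntegral_of_isMaximal N)).symm⟩
  have := hover q
  obtain ⟨T, _, _, _, P, _, _, e, he, Q, _, _, hQq, heQ, hP, -, hQ⟩ :=
    Algebra.exists_etale_isIdempotentElem_forall_liesOver_eq (maximalIdeal R) q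
  obtain ⟨s, hs⟩ := exists_algHom_comap_maximalIdeal_eq_of_etale P hP
  let ψ : T ⊗[R] S →ₐ[R] S :=
    Algebra.TensorProduct.lift ((Algebra.ofId R S).comp s) (AlgHom.id R S) fun _ _ => .all _ _
  have hψ : Function.Surjective ψ := fun x => ⟨1 ⊗ₜ x, by simp [ψ]⟩
  have hψP (N : Ideal S) [N.IsMaximal] : (N.comap ψ).LiesOver P := by
    refine ⟨Ideal.ext fun t => ?_⟩
    rw [← hs, (hover N).over]
    simp [Ideal.mem_comap, ψ, Algebra.ofId_apply]
  have hψq : q.comap ψ = Q := by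
    have := hψP q
    refine Ideal.eq_of_comap_eq_comap_of_bijective_residueFieldMap hP _ _ ?_
    rw [hQq]
    ext x
    simp [Ideal.mem_comap, ψ]
  have hψe : ψ e = 1 := by
    refine (hS _ (he.map ψ)).resolve_left fun h => heQ ?_
    rw [← hψq, Ideal.mem_comap, h]
    exact q.zero_mem
  refine .of_unique_max_ideal ⟨q, hq, fun N hN => ?_⟩
  refine Ideal.comap_injective_of_surjective ψ hψ ((hQ _ inferInstance (hψP N) ?_).trans hψq.symm)
  rw [Ideal.mem_comap, hψe]
  exact (Ideal.ne_top_iff_one N).mp hN.ne_top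

theorem isUnit_or_isUnit_one_sub_of_isIntegral {E : Type*} [Ring E] [Algebra R E]
    (hE : ∀ e : E, IsIdempotentElem e → e = 0 ∨ e = 1) {x : E} (hx : IsIntegral R x) :
    IsUnit x ∨ IsUnit (1 - x) := by
  cases subsingleton_or_nontrivial E
  · exact .inl (isUnit_of_subsingleton x)
  let S := Algebra.adjoin R {x}
  have : IsMulCommutative S := Algebra.isMulCommutative_adjoin R (by simp)
  have : Module.Finite R S := .of_fg hx.fg_adjoin_singleton
  have : IsLocalRing S := isLocalRing_of_forall_isIdempotentElem (R := R) fun e he =>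
    (hE e (he.map S.val)).imp Subtype.ext Subtype.ext
  exact (isUnit_or_isUnit_one_sub_self (⟨x, Algebra.self_mem_adjoin_singleton R x⟩ : S)).imp
    (fun h => h.map S.val) (fun h => h.map S.val)

end Henselian

section FiniteLength

variable {R M : Type*} [CommRing R] [IsLocalRing R] [IsNoetherianRing R] [AddCommGroup M]
  [Module R M] [Module.Finite R M]

theorem isArtinian_of_maximalIdeal_le_radical_annihilator
    (h : maximalIdeal R ≤ (Module.annihilator R M).radical) : IsArtinian R M := by
  rcases eq_or_ne (Module.annihilator R M) ⊤ with htop | hne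
  · have := Module.annihilator_eq_top_iff.mp htop
    infer_instance
  have hmin : maximalIdeal R ∈ (Module.annihilator R M).minimalPrimes :=
    ⟨⟨inferInstance, le_maximalIdeal hne⟩, fun q hq _ => h.trans (hq.1.radical_le_iff.mpr hq.2)⟩
  have := quotient_artinian_of_mem_minimalPrimes_of_isLocalRing _ hmin
  have htors := (Module.isTorsionBySet_annihilator R M)
  let := htors.module
  have : IsScalarTower R (R ⧸ Module.annihilator R M) M := htors.isScalarTower
  have : Module.Finite (R ⧸ Module.annihilator R M) M := .of_restrictScalars_finite R _ _
  exact isArtinian_of_surjective_algebraMap (R := R ⧸ Module.annihilator R M)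
    Ideal.Quotient.mk_surjective

theorem iInf_sup_maximalIdeal_pow_smul_top (N : Submodule R M) :
    ⨅ k : ℕ, N ⊔ maximalIdeal R ^ k • ⊤ = N := by
  have hk (k : ℕ) : (maximalIdeal R ^ k • ⊤ : Submodule R (M ⧸ N)).comap N.mkQ =
      N ⊔ maximalIdeal R ^ k • ⊤ := by
    rw [← Submodule.range_mkQ N, ← Submodule.map_top, ← Submodule.map_smul'',
      Submodule.comap_map_eq, Submodule.ker_mkQ, sup_comm]
  simp_rw [← hk]
  rw [← Submodule.comap_iInf, Ideal.iInf_pow_smul_eq_bot_of_isLocalRing (maximalIdeal R)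
    (Ideal.IsPrime.ne_top inferInstance), ← LinearMap.ker, Submodule.ker_mkQ]

theorem isArtinian_of_forall_exists_pow_smul_eq_zero
    (h : ∀ r ∈ maximalIdeal R, ∀ x : M, ∃ n : ℕ, r ^ n • x = 0) : IsArtinian R M := by
  refine isArtinian_of_maximalIdeal_le_radical_annihilator fun r hr => ?_
  obtain ⟨s, hs⟩ := Module.Finite.fg_top (R := R) (M := M)
  choose n hn using h r hr
  refine ⟨s.sup n, ?_⟩
  rw [← Submodule.annihilator_top, ← hs, Submodule.mem_annihilator_span]
  intro x
  rw [← Nat.sub_add_cancel (Finset.le_sup (f := n) x.2), pow_add, mul_smul, hn, smul_zero]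

open TensorProduct in
instance isArtinian_quotient_maximalIdeal_pow_tensorProduct (k : ℕ) :
    IsArtinian R ((R ⧸ maximalIdeal R ^ k) ⊗[R] M) := by
  refine isArtinian_of_maximalIdeal_le_radical_annihilator fun r hr =>
    ⟨k, Module.mem_annihilator.mpr fun x => ?_⟩
  have hzero : algebraMap R (R ⧸ maximalIdeal R ^ k) (r ^ k) = 0 :=
    Ideal.Quotient.eq_zero_iff_mem.mpr (Ideal.pow_mem_pow hr k)
  rw [← algebraMap_smul (R ⧸ maximalIdeal R ^ k), hzero, zero_smul]

end FiniteLength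

section Miyata

open TensorProduct

section Length

variable {R A B C : Type*} [Ring R] [AddCommGroup A] [Module R A] [AddCommGroup B] [Module R B]
  [AddCommGroup C] [Module R C] {i : A →ₗ[R] B} {p : B →ₗ[R] C}

theorem injective_of_exact_of_linearEquiv_prod_of_isFiniteLength [IsNoetherian R A]
    [IsArtinian R A] [IsNoetherian R C] [IsArtinian R C] (hp : Function.Surjective p)
    (h : Function.Exact i p) (e : B ≃ₗ[R] A × C) : Function.Injective i := by
  have hB : Module.length R B = Module.length R i.range + Module.length R C :=
    Module.length_eq_add_of_exact i.range.subtype p (Submodule.subtype_injective _) hp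
      (by rw [LinearMap.exact_iff, Submodule.range_subtype, h.linearMap_ker_eq])
  have hA : Module.length R A = Module.length R i.ker + Module.length R i.range :=
    Module.length_eq_add_of_exact i.ker.subtype i.rangeRestrict (Submodule.subtype_injective _)
      i.surjective_rangeRestrict
      (by rw [LinearMap.exact_iff, Submodule.range_subtype, LinearMap.ker_rangeRestrict])
  rw [e.length_eq, Module.length_prod] at hB
  rw [← WithTop.add_right_cancel Module.length_ne_top hB] at hA
  have hker : Module.length R i.ker = 0 :=
    WithTop.add_right_cancel Module.length_ne_top (hA.symm.trans (zero_add _).symm)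
  rwa [Module.length_eq_zero_iff, Submodule.subsingleton_iff_eq_bot, LinearMap.ker_eq_bot] at hker

end Length

section Extension

variable {R P Q A B : Type*} [CommRing R] [AddCommGroup P] [Module R P] [Module.Free R P]
  [Module.Finite R P] [AddCommGroup Q] [Module R Q] [Module.Free R Q] [Module.Finite R Q]
  [AddCommGroup A] [Module R A] [AddCommGroup B] [Module R B]

theorem exists_comp_eq_of_lTensor_injective {ρ : P →ₗ[R] Q} {i : A →ₗ[R] B}
    (hi : Function.Injective (i.lTensor (Module.Dual R P ⧸ ρ.dualMap.range)))
    {z : P →ₗ[R] A} {y : Q →ₗ[R] B} (h : i ∘ₗ z = y ∘ₗ ρ) : ∃ x : Q →ₗ[R] A, x ∘ₗ ρ = z := by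
  have hexact := LinearMap.exact_map_mkQ_range ρ.dualMap
  obtain ⟨z, rfl⟩ := (dualTensorHomEquiv R P A).surjective z
  obtain ⟨y, rfl⟩ := (dualTensorHomEquiv R Q B).surjective y
  have hzy : i.lTensor _ z = ρ.dualMap.rTensor B y := by
    apply (dualTensorHomEquiv R P B).injective
    exact (congr($(dualTensorHom_comp_lTensor i) z)).trans
      (h.trans congr($(dualTensorHom_comp_rTensor_dualMap ρ) y).symm)
  have hz : ρ.dualMap.range.mkQ.rTensor A z = 0 := hi <| by
    rw [map_zero, ← LinearMap.comp_apply, LinearMap.lTensor_comp_rTensor,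
      ← LinearMap.rTensor_comp_lTensor, LinearMap.comp_apply, hzy]
    exact (rTensor_exact B hexact (Submodule.mkQ_surjective _)).apply_apply_eq_zero y
  obtain ⟨x, rfl⟩ := (rTensor_exact A hexact (Submodule.mkQ_surjective _) z).mp hz
  exact ⟨dualTensorHom R Q A x, congr($(dualTensorHom_comp_rTensor_dualMap ρ) x).symm⟩

end Extension

section Splitting

variable {R : Type u} {A B C : Type*} [CommRing R] [AddCommGroup A] [Module R A] [AddCommGroup B]
  [Module R B] [AddCommGroup C] [Module R C] {i : A →ₗ[R] B} {p : B →ₗ[R] C}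

theorem exists_comp_eq_id_of_forall_lTensor_injective [Module.FinitePresentation R C]
    (hp : Function.Surjective p) (h : Function.Exact i p)
    (hi : ∀ (W : Type u) [AddCommGroup W] [Module R W] [Module.Finite R W],
      Function.Injective (i.lTensor W)) :
    ∃ s : C →ₗ[R] B, p ∘ₗ s = LinearMap.id := by
  obtain ⟨n, m, π, ρ, hπ, hρ⟩ := Module.FinitePresentation.exists_fin' R C
  obtain ⟨y, hy⟩ := Module.projective_lifting_property p π hp
  obtain ⟨z, hz⟩ : ∃ z : (Fin m → R) →ₗ[R] A, i ∘ₗ z = y ∘ₗ ρ := by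
    obtain ⟨z, hz⟩ := Module.projective_lifting_property i.rangeRestrict
      ((y ∘ₗ ρ).codRestrict i.range fun v => (h _).mp <| by
        rw [← LinearMap.comp_apply, ← LinearMap.comp_assoc, hy, hρ.linearMap_comp_eq_zero,
          LinearMap.zero_apply])
      i.surjective_rangeRestrict
    exact ⟨z, LinearMap.ext fun v => congr(($hz v : B))⟩
  obtain ⟨x, rfl⟩ := exists_comp_eq_of_lTensor_injective (hi _) hz
  obtain ⟨s, hs⟩ := (LinearMap.exact_lcomp_of_exact_of_surjective B hρ hπ (y - i ∘ₗ x)).mp <| by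
    rw [LinearMap.lcomp_apply', LinearMap.sub_comp, LinearMap.comp_assoc, hz, sub_self]
  refine ⟨s, (LinearMap.cancel_right hπ).mp ?_⟩
  rw [LinearMap.comp_assoc, show s ∘ₗ π = y - i ∘ₗ x from hs, LinearMap.comp_sub, hy,
    ← LinearMap.comp_assoc, h.linearMap_comp_eq_zero, LinearMap.zero_comp, sub_zero,
    LinearMap.id_comp]

variable [IsLocalRing R] [IsNoetherianRing R] [Module.Finite R A] [Module.Finite R C]

theorem injective_of_exact_of_linearEquiv_prod (hp : Function.Surjective p)
    (h : Function.Exact i p) (e : B ≃ₗ[R] A × C) : Function.Injective i := by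
  have hk (k : ℕ) : Function.Injective (i.lTensor (R ⧸ maximalIdeal R ^ k)) :=
    injective_of_exact_of_linearEquiv_prod_of_isFiniteLength
      (LinearMap.lTensor_surjective _ hp) (lTensor_exact _ h hp)
      (e.lTensor _ ≪≫ₗ TensorProduct.prodRight R R _ A C)
  rw [← LinearMap.ker_eq_bot, eq_bot_iff, ← iInf_sup_maximalIdeal_pow_smul_top (⊥ : Submodule R A)]
  refine le_iInf fun k x hx => ?_
  rw [bot_sup_eq, ← Submodule.Quotient.mk_eq_zero, ← quotTensorEquivQuotSMul_mk_one_tmul,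
    LinearEquiv.map_eq_zero_iff]
  apply hk k
  rw [LinearMap.lTensor_tmul, hx, tmul_zero, map_zero]

/-- Miyata's theorem. -/
theorem exists_comp_eq_id_of_linearEquiv_prod (hp : Function.Surjective p)
    (h : Function.Exact i p) (e : B ≃ₗ[R] A × C) : ∃ s : C →ₗ[R] B, p ∘ₗ s = LinearMap.id :=
  have := Module.finitePresentation_of_finite R C
  exists_comp_eq_id_of_forall_lTensor_injective hp h fun W _ _ _ =>
    injective_of_exact_of_linearEquiv_prod (LinearMap.lTensor_surjective W hp)
      (lTensor_exact W h hp) (e.lTensor W ≪≫ₗ TensorProduct.prodRight R R W A C)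

end Splitting

end Miyata

section Pullback

variable {R : Type u} {X M₁ M₀ : Type*} [CommRing R] [AddCommGroup X] [Module R X]
  [AddCommGroup M₁] [Module R M₁] [AddCommGroup M₀] [Module R M₀]

/-- The pullback of two linear maps, as a submodule of the product. -/
abbrev linearPullback (γ : M₁ →ₗ[R] M₀) (f : X →ₗ[R] M₀) : Submodule R (M₁ × X) :=
  LinearMap.eqLocus (γ ∘ₗ LinearMap.fst R M₁ X) (f ∘ₗ LinearMap.snd R M₁ X)

/-- The inclusion of the kernel of `γ` as the kernel of the projection of the pullback to `X`. -/
def linearPullbackInl (γ : M₁ →ₗ[R] M₀) (f : X →ₗ[R] M₀) : γ.ker →ₗ[R] linearPullback γ f :=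
  (LinearMap.inl R M₁ X).restrict fun x (hx : γ x = 0) => show γ x = f 0 by rw [hx, map_zero]

/-- The projection of the pullback to `X`. -/
def linearPullbackSnd (γ : M₁ →ₗ[R] M₀) (f : X →ₗ[R] M₀) : linearPullback γ f →ₗ[R] X :=
  LinearMap.snd R M₁ X ∘ₗ Submodule.subtype _

theorem linearPullbackInl_injective (γ : M₁ →ₗ[R] M₀) (f : X →ₗ[R] M₀) :
    Function.Injective (linearPullbackInl γ f) := fun _ _ h =>
  Subtype.ext congr(($h).1.1)

theorem linearPullbackSnd_surjective {γ : M₁ →ₗ[R] M₀} (hγ : Function.Surjective γ)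
    (f : X →ₗ[R] M₀) : Function.Surjective (linearPullbackSnd γ f) := fun x =>
  let ⟨a, ha⟩ := hγ (f x)
  ⟨⟨(a, x), ha⟩, rfl⟩

theorem exact_linearPullbackInl_linearPullbackSnd (γ : M₁ →ₗ[R] M₀) (f : X →ₗ[R] M₀) :
    Function.Exact (linearPullbackInl γ f) (linearPullbackSnd γ f) := by
  rintro ⟨⟨a, x⟩, hax⟩
  constructor
  · rintro (rfl : x = 0)
    exact ⟨⟨a, Eq.trans hax (map_zero f)⟩, rfl⟩
  · rintro ⟨y, hy⟩
    exact congr(($hy).1.2).symm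

variable [IsLocalRing R] [IsNoetherianRing R] [Module.Finite R X] [Module.Finite R M₁]
  {γ : M₁ →ₗ[R] M₀}

theorem exists_eq_comp_add_smul_of_linearPullback_equiv (hγ : Function.Surjective γ)
    {f : X →ₗ[R] M₀} {s : R} (e : linearPullback γ f ≃ₗ[R] linearPullback γ (s • f)) :
    ∃ (h : X →ₗ[R] M₁) (t : X →ₗ[R] X), f = γ ∘ₗ h + s • (f ∘ₗ t) := by
  -- Apply Miyata's theorem to `0 → P(s f) → P(f) × X → X → 0`, where `P` denotes the pullback and
  -- the maps are `(a, x) ↦ ((a, s x), x)` and `((a, y), x) ↦ y - s x`.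
  let i : linearPullback γ (s • f) →ₗ[R] linearPullback γ f × X :=
    LinearMap.prod
      ((LinearMap.id.prodMap (s • LinearMap.id)).restrict fun x hx => by
        simpa [LinearMap.mem_eqLocus] using hx)
      (linearPullbackSnd γ (s • f))
  let p : linearPullback γ f × X →ₗ[R] X :=
    LinearMap.coprod (linearPullbackSnd γ f) (-(s • LinearMap.id))
  have hp_apply (x) : p x = x.1.1.2 - s • x.2 := by simp [p, linearPullbackSnd, sub_eq_add_neg]
  have hp : Function.Surjective p := fun x => by
    obtain ⟨a, ha⟩ := hγ (f x)
    exact ⟨(⟨(a, x), ha⟩, 0), by simp [p, linearPullbackSnd]⟩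
  have hexact : Function.Exact i p := by
    rintro ⟨⟨⟨a, y⟩, hay⟩, x⟩
    rw [hp_apply, sub_eq_zero]
    constructor
    · rintro (rfl : y = s • x)
      exact ⟨⟨(a, x), Eq.trans hay (map_smul f s x)⟩, rfl⟩
    · rintro ⟨z, hz⟩
      obtain ⟨hz, rfl⟩ := Prod.ext_iff.mp hz
      exact congr(($hz).1.2).symm
  obtain ⟨σ, hσ⟩ := exists_comp_eq_id_of_linearEquiv_prod hp hexact
    (e.prodCongr (LinearEquiv.refl R X))
  refine ⟨LinearMap.fst R M₁ X ∘ₗ Submodule.subtype _ ∘ₗ LinearMap.fst R _ X ∘ₗ σ,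
    -(LinearMap.snd R _ X ∘ₗ σ), LinearMap.ext fun x => ?_⟩
  have hx : (σ x).1.1.2 - s • (σ x).2 = x := (hp_apply _).symm.trans congr($hσ x)
  have hσx : γ (σ x).1.1.1 = f (σ x).1.1.2 := (σ x).1.2
  change f x = γ (σ x).1.1.1 + s • f (-(σ x).2)
  rw [hσx, ← map_smul, ← map_add, smul_neg, ← sub_eq_add_neg, hx]

theorem exists_pow_smul_eq_comp_of_linearPullback_equiv [Module.Finite R M₀]
    (hγ : Function.Surjective γ) {κ : Type*} [Finite κ] (c : (X →ₗ[R] M₀) → κ)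
    (hc : ∀ f g, c f = c g → Nonempty (linearPullback γ f ≃ₗ[R] linearPullback γ g))
    {r : R} (hr : r ∈ maximalIdeal R) (f : X →ₗ[R] M₀) :
    ∃ (n : ℕ) (g : X →ₗ[R] M₁), r ^ n • f = γ ∘ₗ g := by
  -- By the pigeonhole principle infinitely many `n` give isomorphic pullbacks of `r ^ n • f`; for
  -- any such `m`, `r ^ m • f` lies in the range of `γ ∘ -` up to arbitrary powers of `r`.
  obtain ⟨a, ha⟩ := Finite.exists_infinite_fiber fun n : ℕ => c (r ^ n • f)
  have hinf := Set.infinite_coe_iff.mp ha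
  obtain ⟨m, hm⟩ := hinf.nonempty
  suffices r ^ m • f ∈ (γ.compRight R : (X →ₗ[R] M₁) →ₗ[R] _).range by
    obtain ⟨g, hg⟩ := this
    exact ⟨m, g, hg.symm⟩
  rw [← iInf_sup_maximalIdeal_pow_smul_top (LinearMap.range _), Submodule.mem_iInf]
  intro k
  obtain ⟨n, hn, hmn⟩ := hinf.exists_gt (k + m)
  obtain ⟨d, rfl⟩ := Nat.exists_eq_add_of_le' (Nat.le_of_add_left_le hmn.le)
  obtain ⟨e⟩ := hc _ _ (hm.trans hn.symm)
  rw [pow_add, mul_smul] at e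
  obtain ⟨g, t, hgt⟩ := exists_eq_comp_add_smul_of_linearPullback_equiv hγ e
  rw [hgt]
  have hrd : r ^ d ∈ maximalIdeal R ^ k :=
    Ideal.pow_le_pow_right (Nat.add_lt_add_iff_right.mp hmn).le (Ideal.pow_mem_pow hr d)
  exact Submodule.add_mem_sup ⟨g, rfl⟩ (Submodule.smul_mem_smul hrd Submodule.mem_top)

end Pullback

section Generators

open TensorProduct

/-- The minimal number of generators of a finite module over a local ring; by Nakayama's lemma it
is the dimension of its reduction modulo the maximal ideal. -/
noncomputable def minGens (R M : Type*) [CommRing R] [IsLocalRing R] [AddCommGroup M]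
    [Module R M] : ℕ :=
  Module.finrank (ResidueField R) (ResidueField R ⊗[R] M)

variable {R A B C : Type*} [CommRing R] [IsLocalRing R] [AddCommGroup A] [Module R A]
  [AddCommGroup B] [Module R B] [AddCommGroup C] [Module R C]

theorem minGens_congr (e : A ≃ₗ[R] B) : minGens R A = minGens R B :=
  (e.baseChange R (ResidueField R) A B).finrank_eq

variable [Module.Finite R A]

theorem minGens_pos [Nontrivial A] : 0 < minGens R A := by
  have : Nontrivial (ResidueField R ⊗[R] A) := by
    rw [← not_subsingleton_iff_nontrivial, subsingleton_tensorProduct]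
    exact not_subsingleton A
  exact Module.finrank_pos

theorem minGens_prod [Module.Finite R C] : minGens R (A × C) = minGens R A + minGens R C :=
  (TensorProduct.prodRight R (ResidueField R) (ResidueField R) A C).finrank_eq.trans
    Module.finrank_prod

theorem minGens_le_of_exact [Module.Finite R B] [Module.Finite R C] {i : A →ₗ[R] B}
    {p : B →ₗ[R] C} (h : Function.Exact i p) (hp : Function.Surjective p) :
    minGens R B ≤ minGens R A + minGens R C := by
  have hexact : Function.Exact (i.baseChange (ResidueField R)) (p.baseChange (ResidueField R)) :=
    lTensor_exact (ResidueField R) h hp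
  calc minGens R B
    _ = Module.finrank _ (p.baseChange (ResidueField R)).range +
        Module.finrank _ (i.baseChange (ResidueField R)).range := by
      rw [← hexact.linearMap_ker_eq, LinearMap.finrank_range_add_finrank_ker, minGens]
    _ ≤ minGens R C + minGens R A :=
      Nat.add_le_add (Submodule.finrank_le _) (LinearMap.finrank_range_le _)
    _ = minGens R A + minGens R C := Nat.add_comm _ _

end Generators

section Decomposition

variable {R : Type u} [CommRing R]

theorem exists_linearEquiv_prod_of_not_indecomposable {M : ModuleCat.{u} R} [Nontrivial M]
    (hM : ¬ Indecomposable M) : ∃ A B : ModuleCat.{u} R, Nontrivial A ∧ Nontrivial B ∧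
      Nonempty (M ≃ₗ[R] A × B) := by
  simp only [Indecomposable, ModuleCat.isZero_iff_subsingleton, not_subsingleton M,
    not_false_eq_true, true_and, not_forall, not_or, not_subsingleton_iff_nontrivial] at hM
  obtain ⟨A, B, e, hA, hB⟩ := hM
  exact ⟨A, B, hA, hB, ⟨(e ≪≫ ModuleCat.biprodIsoProd A B).toLinearEquiv⟩⟩

theorem exists_linearEquiv_pi_indecomposable [IsLocalRing R] (M : ModuleCat.{u} R)
    [Module.Finite R M] : ∃ (n : ℕ) (N : Fin n → ModuleCat.{u} R), n ≤ minGens R M ∧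
      (∀ i, Indecomposable (N i)) ∧ Nonempty (M ≃ₗ[R] Π i, N i) := by
  induction hn : minGens R M using Nat.strong_induction_on generalizing M with
  | _ n ih =>
    subst hn
    rcases subsingleton_or_nontrivial M with _ | _
    · exact ⟨0, Fin.elim0, Nat.zero_le _, fun i => i.elim0, ⟨LinearEquiv.ofSubsingleton _ _⟩⟩
    by_cases hM : Indecomposable M
    · exact ⟨1, fun _ => M, minGens_pos, fun _ => hM, ⟨(LinearEquiv.funUnique (Fin 1) R M).symm⟩⟩
    obtain ⟨A, B, _, _, ⟨e⟩⟩ := exists_linearEquiv_prod_of_not_indecomposable hM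
    have : Module.Finite R (A × B) := .equiv e
    have : Module.Finite R A := .of_surjective (LinearMap.fst R A B) LinearMap.fst_surjective
    have : Module.Finite R B := .of_surjective (LinearMap.snd R A B) LinearMap.snd_surjective
    have hAB : minGens R M = minGens R A + minGens R B := (minGens_congr e).trans minGens_prod
    obtain ⟨a, X, ha, hX, ⟨eX⟩⟩ := ih _ (hAB ▸ Nat.lt_add_of_pos_right minGens_pos) A rfl
    obtain ⟨b, Y, hb, hY, ⟨eY⟩⟩ := ih _ (hAB ▸ Nat.lt_add_of_pos_left minGens_pos) B rfl
    let N : Fin a ⊕ Fin b → ModuleCat.{u} R := Sum.elim X Y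
    have hN : ∀ t, Indecomposable (N t) := Sum.forall.mpr ⟨hX, hY⟩
    refine ⟨a + b, N ∘ finSumFinEquiv.symm, hAB ▸ Nat.add_le_add ha hb, fun i => hN _, ⟨?_⟩⟩
    exact e ≪≫ₗ eX.prodCongr eY ≪≫ₗ (LinearEquiv.sumPiEquivProdPi R _ _ fun t => N t).symm ≪≫ₗ
      LinearEquiv.piCongrLeft' R (fun t => N t) finSumFinEquiv

end Decomposition

section MCMClosure

open Abelian

variable {R : Type u} [CommRing R] [IsLocalRing R]

instance : (isMCM R).IsStableUnderRetracts where
  of_retract {M N} h hN := by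
    have := hN.1
    refine ⟨.of_surjective h.r.hom fun x => ⟨h.i.hom x, congr($(h.retract) x)⟩, fun n hn => ?_⟩
    have := hN.2 n hn
    refine subsingleton_of_forall_eq 0 fun x => ?_
    calc x = (x.comp (Ext.mk₀ h.i) (add_zero n)).comp (Ext.mk₀ h.r) (add_zero n) := by
          rw [Ext.comp_assoc_of_third_deg_zero, Ext.mk₀_comp_mk₀, h.retract, Ext.comp_mk₀_id]
      _ = 0 := by rw [Subsingleton.elim (x.comp _ _) 0, Ext.zero_comp]

instance : (isMCM R).IsClosedUnderExtensions where
  prop_X₂_of_shortExact {S} hS h₁ h₃ := by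
    have := h₁.1
    have := h₃.1
    have hexact := (ShortComplex.ShortExact.moduleCat_exact_iff_function_exact S).mp hS.exact
    refine ⟨.of_exact hexact hS.moduleCat_surjective_g, fun n hn => ?_⟩
    have := h₁.2 n hn
    have := h₃.2 n hn
    refine subsingleton_of_forall_eq 0 fun x => ?_
    obtain ⟨y, rfl⟩ := Ext.covariant_sequence_exact₂ _ hS x (Subsingleton.elim _ _)
    rw [Subsingleton.elim y 0, Ext.zero_comp]

instance : (isMCM R).IsClosedUnderBinaryProducts where
  limitsOfShape_le := by
    rintro P ⟨p⟩
    have e : p.diag.obj ⟨.left⟩ ⊞ p.diag.obj ⟨.right⟩ ≅ P :=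
      (BinaryBiproduct.isLimit _ _).conePointsIsoOfNatIso p.isLimit (diagramIsoPair _).symm
    exact (isMCM R).prop_of_iso e ((isMCM R).prop_biprod (p.prop_diag_obj _) (p.prop_diag_obj _))

instance : HasBinaryBiproducts (MCMCat R) :=
  HasBinaryBiproducts.of_hasBinaryProducts

theorem isMCM.X₁_of_shortExact [IsNoetherianRing R] {S : ShortComplex (ModuleCat.{u} R)}
    (hS : S.ShortExact) (h₂ : isMCM R S.X₂) (h₃ : isMCM R S.X₃) : isMCM R S.X₁ := by
  have := h₂.1
  refine ⟨.of_injective S.f.hom hS.moduleCat_injective_f, fun n hn => ?_⟩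
  have := h₂.2 n hn
  refine subsingleton_of_forall_eq 0 fun x => ?_
  cases n with
  | zero =>
    have := hS.mono_f
    exact Ext.postcomp_mk₀_injective_of_mono _ S.f (Subsingleton.elim _ _)
  | succ n =>
    have := h₃.2 n (lt_of_le_of_lt (by exact_mod_cast n.le_succ) hn)
    obtain ⟨y, rfl⟩ := Ext.covariant_sequence_exact₁ _ hS x (Subsingleton.elim _ _) rfl
    rw [Subsingleton.elim y 0, Ext.zero_comp]

theorem isMCM.ker [IsNoetherianRing R] {M N : ModuleCat.{u} R} (hM : isMCM R M) (hN : isMCM R N)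
    {f : M →ₗ[R] N} (hf : Function.Surjective f) : isMCM R (ModuleCat.of R f.ker) :=
  isMCM.X₁_of_shortExact (LinearMap.shortExact_shortComplexKer hf) hM hN

theorem isMCM_linearPullback [IsNoetherianRing R] {M₀ M₁ X : ModuleCat.{u} R} (h₀ : isMCM R M₀)
    (h₁ : isMCM R M₁) (hX : isMCM R X) {γ : M₁ →ₗ[R] M₀} (hγ : Function.Surjective γ)
    (f : X →ₗ[R] M₀) : isMCM R (ModuleCat.of R (linearPullback γ f)) := by
  have hexact := exact_linearPullbackInl_linearPullbackSnd γ f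
  let S := ModuleCat.shortComplexOfCompEqZero _ _ hexact.linearMap_comp_eq_zero
  have hS : S.ShortExact := ModuleCat.shortComplex_shortExact S hexact
    (linearPullbackInl_injective γ f) (linearPullbackSnd_surjective hγ f)
  exact (isMCM R).prop_X₂_of_shortExact hS (h₁.ker h₀ hγ) hX

end MCMClosure

section Homs

variable {R : Type u} [CommRing R] [IsLocalRing R]

/-- Morphisms of maximal Cohen-Macaulay modules are linear maps. -/
def MCMCat.homLinearEquiv (M N : MCMCat R) : (M ⟶ N) ≃ₗ[R] (M.obj →ₗ[R] N.obj) :=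
  InducedCategory.homLinearEquiv.trans ModuleCat.homLinearEquiv

instance [IsNoetherianRing R] (M N : MCMCat R) : Module.Finite R (M ⟶ N) := by
  have := M.property.1
  have := N.property.1
  exact .equiv (MCMCat.homLinearEquiv M N).symm

end Homs

section KrullSchmidt

variable {R : Type u} [CommRing R] [IsLocalRing R] {κ : Type*} {X : κ → ModuleCat.{u} R}

theorem isMCM.exists_linearEquiv_pi
    (hX : ∀ N, isMCM R N → Indecomposable N → ∃ k, Nonempty (N ≅ X k)) {M : ModuleCat.{u} R}
    (hM : isMCM R M) :
    ∃ n ≤ minGens R M, ∃ j : Fin n → κ, Nonempty (M ≃ₗ[R] Π t, X (j t)) := by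
  have := hM.1
  obtain ⟨n, N, hn, hN, ⟨e⟩⟩ := exists_linearEquiv_pi_indecomposable M
  have hMCM (t : Fin n) : isMCM R (N t) := (isMCM R).prop_of_retract
    { i := ModuleCat.ofHom (e.symm ∘ₗ LinearMap.single R (fun t => N t) t)
      r := ModuleCat.ofHom (LinearMap.proj t ∘ₗ (e : M →ₗ[R] Π t, N t))
      retract := by ext; simp } hM
  choose j hj using fun t => hX (N t) (hMCM t) (hN t)
  exact ⟨n, hn, j, ⟨e ≪≫ₗ LinearEquiv.piCongrRight fun t => (hj t).some.toLinearEquiv⟩⟩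

theorem isMCM.exists_pow_smul_eq_comp [IsNoetherianRing R] [Finite κ]
    (hX : ∀ N, isMCM R N → Indecomposable N → ∃ k, Nonempty (N ≅ X k))
    {M₀ M₁ Y : ModuleCat.{u} R} (h₀ : isMCM R M₀) (h₁ : isMCM R M₁) (hY : isMCM R Y)
    {γ : M₁ →ₗ[R] M₀} (hγ : Function.Surjective γ) {r : R} (hr : r ∈ maximalIdeal R)
    (f : Y →ₗ[R] M₀) : ∃ (n : ℕ) (g : Y →ₗ[R] M₁), r ^ n • f = γ ∘ₗ g := by
  have := h₀.1
  have := h₁.1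
  have := hY.1
  let b := minGens R γ.ker + minGens R Y
  have hdecomp (f : Y →ₗ[R] M₀) : ∃ c : Σ n : Fin (b + 1), Fin n → κ,
      Nonempty (linearPullback γ f ≃ₗ[R] Π t, X (c.2 t)) := by
    obtain ⟨n, hn, j, e⟩ := (isMCM_linearPullback h₀ h₁ hY hγ f).exists_linearEquiv_pi hX
    have hb : minGens R (linearPullback γ f) ≤ b := minGens_le_of_exact
      (exact_linearPullbackInl_linearPullbackSnd γ f) (linearPullbackSnd_surjective hγ f)
    exact ⟨⟨⟨n, Nat.lt_succ_of_le (hn.trans hb)⟩, j⟩, e⟩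
  choose c hc using hdecomp
  refine exists_pow_smul_eq_comp_of_linearPullback_equiv hγ c (fun f g hfg => ?_) hr f
  have hg := hc g
  rw [← hfg] at hg
  exact ⟨(hc f).some ≪≫ₗ hg.some.symm⟩

theorem MCMCat.exists_id_eq_sum {X : κ → MCMCat R}
    (hX : ∀ N, isMCM R N → Indecomposable N → ∃ k, Nonempty (N ≅ (X k).obj)) (M : MCMCat R) :
    ∃ (n : ℕ) (j : Fin n → κ) (a : ∀ t, M ⟶ X (j t)) (b : ∀ t, X (j t) ⟶ M),
      𝟙 M = ∑ t, a t ≫ b t := by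
  obtain ⟨n, -, j, ⟨e⟩⟩ := M.property.exists_linearEquiv_pi hX
  let a (t) : M.obj →ₗ[R] (X (j t)).obj := LinearMap.proj t ∘ₗ e.toLinearMap
  let b (t) : (X (j t)).obj →ₗ[R] M.obj := e.symm ∘ₗ LinearMap.single R (fun t => (X (j t)).obj) t
  have hab : LinearMap.id = ∑ t, b t ∘ₗ a t := LinearMap.ext fun x => e.injective <| by
    simp [a, b, Finset.univ_sum_single]
  refine ⟨n, j, fun t => ObjectProperty.homMk (ModuleCat.ofHom (a t)),
    fun t => ObjectProperty.homMk (ModuleCat.ofHom (b t)), ?_⟩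
  apply (MCMCat.homLinearEquiv M M).injective
  rw [map_sum]
  exact hab

end KrullSchmidt

section LocalEnd

theorem isUnit_of_mul_eq_one_of_isLocalRing {E : Type*} [Ring E] [IsLocalRing E] {c x : E}
    (h : c * x = 1) : IsUnit x := by
  rcases isUnit_or_isUnit_of_add_one (add_sub_cancel (x * c) 1) with hxc | hxc
  · obtain ⟨d, hd⟩ := hxc.exists_right_inv
    rw [mul_assoc] at hd
    exact isUnit_iff_exists_and_exists.mpr ⟨⟨_, hd⟩, ⟨c, h⟩⟩
  · have hx : (1 - x * c) * x = 0 := by rw [sub_mul, mul_assoc, h, one_mul, mul_one, sub_self]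
    rw [hxc.mul_right_eq_zero] at hx
    rw [hx, mul_zero] at h
    exact absurd h zero_ne_one

theorem mem_jacobson_iff_not_isUnit {E : Type*} [Ring E] [IsLocalRing E] {x : E} :
    x ∈ Ring.jacobson E ↔ ¬ IsUnit x := by
  rw [← Ideal.jacobson_bot]
  constructor
  · intro hx hu
    exact bot_ne_top (Ideal.jacobson_eq_top_iff.mp (Ideal.eq_top_of_isUnit_mem _ hx hu))
  · intro hx
    refine Ideal.mem_jacobson_iff.mpr fun y => ?_
    have hyx : ¬ IsUnit (-(y * x)) := fun hu => by
      obtain ⟨u, hu⟩ := ((IsUnit.neg_iff _).mp hu).exists_left_inv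
      exact hx (isUnit_of_mul_eq_one_of_isLocalRing ((mul_assoc u y x).trans hu))
    obtain ⟨z, hz⟩ := ((isUnit_or_isUnit_of_add_one (neg_add_cancel_left (y * x) 1)).resolve_left
      hyx).exists_left_inv
    exact ⟨z, by rw [Ideal.mem_bot, ← hz, mul_add, mul_one, mul_assoc, sub_self]⟩

theorem isUnit_one_sub_of_mem_jacobson {E : Type*} [Ring E] [IsLocalRing E] {x : E}
    (hx : x ∈ Ring.jacobson E) : IsUnit (1 - x) :=
  (isUnit_or_isUnit_of_add_one (add_sub_cancel x 1)).resolve_left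
    (mem_jacobson_iff_not_isUnit.mp hx)

variable {R : Type u} [CommRing R] [HenselianLocalRing R]

theorem isLocalRing_end_of_indecomposable {M : ModuleCat.{u} R} [Module.Finite R M]
    (hM : Indecomposable M) : IsLocalRing (Module.End R M) := by
  have hidem (e : Module.End R M) (he : IsIdempotentElem e) : e = 0 ∨ e = 1 := by
    let decomposition : M ≅ ModuleCat.of R e.range ⊞ ModuleCat.of R e.ker :=
      (Submodule.prodEquivOfIsCompl _ _ (LinearMap.IsIdempotentElem.isCompl he)).symm.toModuleIso ≪≫
        (ModuleCat.biprodIsoProd (.of R e.range) (.of R e.ker)).symm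
    simp only [Indecomposable, ModuleCat.isZero_iff_subsingleton] at hM
    refine (hM.2 _ _ decomposition).imp (fun h => ?_) fun h => ?_
    · exact LinearMap.range_eq_bot.mp (Submodule.subsingleton_iff_eq_bot.mp h)
    · have hinj := LinearMap.ker_eq_bot.mp (Submodule.subsingleton_iff_eq_bot.mp h)
      exact LinearMap.ext fun x => hinj congr($he x)
  have : Nontrivial M := by
    simpa only [ModuleCat.isZero_iff_subsingleton, not_subsingleton_iff_nontrivial] using hM.1
  exact .of_isUnit_or_isUnit_one_sub_self fun φ =>
    isUnit_or_isUnit_one_sub_of_isIntegral hidem (Algebra.IsIntegral.isIntegral (R := R) φ)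

theorem MCMCat.isLocalRing_end {M : MCMCat R} (hM : Indecomposable M.obj) :
    IsLocalRing (End M) := by
  have := M.property.1
  have := isLocalRing_end_of_indecomposable hM
  let e : End M ≃+* End M.obj :=
    { (isMCM R).fullyFaithfulι.mulEquivEnd M with map_add' := fun _ _ => rfl }
  exact (e.trans M.obj.endRingEquiv : End M →+* Module.End R M.obj).domain_isLocalRing

end LocalEnd

section AbelianCategories

variable {𝒜 : Type*} [Category 𝒜] [Abelian 𝒜]

lemma not_isZero_cokernel_ofLE_of_lt {F : 𝒜} {G H : Subobject F} (h : G < H) :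
    ¬ IsZero (cokernel (Subobject.ofLE G H h.le)) := fun hzero => by
  have : Epi (Subobject.ofLE G H h.le) := Preadditive.epi_of_isZero_cokernel _ hzero
  have : IsIso (Subobject.ofLE G H h.le) := isIso_of_mono_of_epi _
  refine h.not_ge (Subobject.le_of_comm (inv (Subobject.ofLE G H h.le)) ?_)
  rw [IsIso.inv_comp_eq, Subobject.ofLE_arrow]

theorem simple_cokernel_ofLE_of_covBy {F : 𝒜} {G H : Subobject F} (h : G ⋖ H) :
    Simple (cokernel (Subobject.ofLE G H h.le)) := by
  set π := cokernel.π (Subobject.ofLE G H h.le)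
  refine ⟨fun {Y} i _ => ⟨?_, fun hi => ?_⟩⟩
  · rintro hiso rfl
    exact not_isZero_cokernel_ofLE_of_lt h.lt
      ((IsZero.iff_isSplitEpi_eq_zero (0 : Y ⟶ _)).mpr rfl)
  · let K : Subobject F := Subobject.mk (pullback.fst π i ≫ H.arrow)
    have hGK : G ≤ K := Subobject.le_mk_of_comm
      (pullback.lift (Subobject.ofLE G H h.le) 0 (by rw [cokernel.condition, zero_comp]))
      (by rw [pullback.lift_fst_assoc, Subobject.ofLE_arrow])
    have hKH : K ≤ H := Subobject.mk_le_of_comm (pullback.fst π i) rfl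
    rcases h.eq_or_eq hGK hKH with hK | hK
    · have hfst : pullback.fst π i ≫ π = 0 := by
        have : pullback.fst π i = Subobject.ofMkLE _ G hK.le ≫ Subobject.ofLE G H h.le := by
          rw [← cancel_mono H.arrow, Category.assoc, Subobject.ofLE_arrow, Subobject.ofMkLE_arrow]
        rw [this, Category.assoc, cokernel.condition, comp_zero]
      rw [pullback.condition] at hfst
      exact absurd (zero_of_epi_comp _ hfst) hi
    · have hfst : Subobject.ofLEMk H _ hK.ge ≫ pullback.fst π i = 𝟙 _ := by
        rw [← cancel_mono H.arrow, Category.assoc, Subobject.ofLEMk_comp, Category.id_comp]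
      have hπ : (Subobject.ofLEMk H _ hK.ge ≫ pullback.snd π i) ≫ i = π := by
        rw [Category.assoc, ← pullback.condition, reassoc_of% hfst]
      have : Epi i := epi_of_epi_fac hπ
      exact isIso_of_mono_of_epi i

lemma nonempty_iso_of_forall_comp_eq_zero_iff {P : ObjectProperty 𝒜} (hP : P.IsSeparating)
    {B S F : 𝒜} {π : B ⟶ S} {q : B ⟶ F} [Epi π] [Epi q]
    (h : ∀ G, P G → ∀ f : G ⟶ B, f ≫ π = 0 ↔ f ≫ q = 0) : Nonempty (F ≅ S) := by
  have hker {T T' : 𝒜} {a : B ⟶ T} {b : B ⟶ T'}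
      (hab : ∀ G, P G → ∀ f : G ⟶ B, f ≫ a = 0 → f ≫ b = 0) : kernel.ι a ≫ b = 0 :=
    (Preadditive.isSeparating_iff P).mp hP _ fun G hG f => by
      rw [← Category.assoc]
      exact hab G hG _ (by rw [Category.assoc, kernel.condition, comp_zero])
  have hqπ := hker fun G hG f => (h G hG f).mpr
  have hπq := hker fun G hG f => (h G hG f).mp
  refine ⟨⟨Abelian.epiDesc q π hqπ, Abelian.epiDesc π q hπq, ?_, ?_⟩⟩
  · rw [← cancel_epi q, Abelian.comp_epiDesc_assoc, Abelian.comp_epiDesc, Category.comp_id]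
  · rw [← cancel_epi π, Abelian.comp_epiDesc_assoc, Abelian.comp_epiDesc, Category.comp_id]

end AbelianCategories

section ProjectiveGenerators

variable {A : Type*} [Category A] [Preadditive A] {𝒜 : Type*} [Category 𝒜] [Abelian 𝒜]
  (R : Type*) [CommRing R] [Linear R A] {y : A ⥤ 𝒜} [y.Additive] {ι : Type*} {X : ι → A} {M : A}
  {F : 𝒜}

/-- The maps `X ⟶ M` which `p : y M ⟶ F` sends into the subobject `K` of `F`. When `y X` is
projective and `p` is an epimorphism, these are the generalized elements of `K` of shape `y X`. -/
def factorsSubmodule (p : y.obj M ⟶ F) (X : A) (K : Subobject F) : Submodule R (X ⟶ M) where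
  carrier := {f | K.Factors (y.map f ≫ p)}
  zero_mem' := by
    simpa only [Set.mem_ofPred_eq, Functor.map_zero, zero_comp] using Subobject.factors_zero
  add_mem' hf hg := by
    simpa only [Set.mem_ofPred_eq, Functor.map_add, Preadditive.add_comp] using
      Subobject.factors_add _ _ hf hg
  smul_mem' r f hf := by
    have h := Subobject.factors_of_factors_right (y.map (r • 𝟙 X)) hf
    rwa [← y.map_comp_assoc, Linear.smul_comp, Category.id_comp] at h

variable {R}

lemma mem_factorsSubmodule {p : y.obj M ⟶ F} {X : A} {K : Subobject F} {f : X ⟶ M} :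
    f ∈ factorsSubmodule R p X K ↔ K.Factors (y.map f ≫ p) :=
  Iff.rfl

lemma factorsSubmodule_mono (p : y.obj M ⟶ F) (X : A) : Monotone (factorsSubmodule R p X) :=
  fun _ _ h _ hf => Subobject.factors_of_le _ h hf

variable [y.Full] [∀ i, Projective (y.obj (X i))]

lemma le_iff_forall_factorsSubmodule_le
    (hX : (ObjectProperty.ofObj fun i => y.obj (X i)).IsSeparating) (p : y.obj M ⟶ F) [Epi p]
    {K L : Subobject F} :
    K ≤ L ↔ ∀ i, factorsSubmodule R p (X i) K ≤ factorsSubmodule R p (X i) L := by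
  refine ⟨fun h i => factorsSubmodule_mono p (X i) h, fun h => inf_eq_left.mp ?_⟩
  refine Subobject.inf_eq_of_isDetecting hX.isDetecting K L fun _ hG f hf => ?_
  obtain ⟨i⟩ := hG
  obtain ⟨a, ha⟩ := y.map_surjective (Projective.factorThru f p)
  have hap : y.map a ≫ p = f := by rw [ha, Projective.factorThru_comp]
  rw [← hap] at hf ⊢
  exact h i hf

variable (R) [Finite ι]

lemma isNoetherianObject_of_isNoetherian [∀ i, IsNoetherian R (X i ⟶ M)]
    (hX : (ObjectProperty.ofObj fun i => y.obj (X i)).IsSeparating) (p : y.obj M ⟶ F) [Epi p] :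
    IsNoetherianObject F := by
  have : WellFoundedGT (∀ i, Submodule R (X i ⟶ M)) :=
    inferInstanceAs (WellFoundedLT (∀ i, (Submodule R (X i ⟶ M))ᵒᵈ))
  let Φ : Subobject F ↪o ∀ i, Submodule R (X i ⟶ M) :=
    OrderEmbedding.ofMapLEIff (fun K i => factorsSubmodule R p (X i) K) fun _ _ =>
      (le_iff_forall_factorsSubmodule_le hX p).symm
  exact ⟨Φ.wellFoundedGT⟩

lemma isArtinianObject_of_isArtinian
    (hX : (ObjectProperty.ofObj fun i => y.obj (X i)).IsSeparating) (p : y.obj M ⟶ F) [Epi p]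
    [∀ i, IsArtinian R ((X i ⟶ M) ⧸ factorsSubmodule R p (X i) ⊥)] :
    IsArtinianObject F := by
  let Φ : Subobject F ↪o ∀ i, Submodule R ((X i ⟶ M) ⧸ factorsSubmodule R p (X i) ⊥) :=
    OrderEmbedding.ofMapLEIff
      (fun K i => (factorsSubmodule R p (X i) K).map (Submodule.mkQ _)) fun K L => by
        rw [le_iff_forall_factorsSubmodule_le (R := R) hX p, Pi.le_def]
        refine forall_congr' fun i => ?_
        rw [Submodule.map_le_iff_le_comap, Submodule.comap_map_mkQ,
          sup_eq_right.mpr (factorsSubmodule_mono p (X i) bot_le)]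
  exact ⟨Φ.wellFoundedLT⟩

end ProjectiveGenerators

section FinitelyGenerated

variable {A : Type*} [Category A] [Preadditive A] [HasBinaryBiproducts A] [Nonempty A]
  {𝒜 : Type*} [Category 𝒜] [Abelian 𝒜] {y : A ⥤ 𝒜} [y.Additive] {ι : Type*} {X : ι → A}

theorem exists_epi_of_isNoetherianObject
    (hX : (ObjectProperty.ofObj fun i => y.obj (X i)).IsSeparating) (F : 𝒜)
    [IsNoetherianObject F] : ∃ (P : A) (q : y.obj P ⟶ F), Epi q := by
  obtain ⟨_, ⟨⟨P, q⟩, rfl⟩, hmax⟩ := wellFounded_gt.has_min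
    (Set.range fun t : Σ P, y.obj P ⟶ F => imageSubobject t.2)
    ⟨_, ⟨⟨Classical.arbitrary A, 0⟩, rfl⟩⟩
  have hfac (i : ι) (f : y.obj (X i) ⟶ F) : (imageSubobject q).Factors f := by
    let q' : y.obj (P ⊞ X i) ⟶ F := y.map biprod.fst ≫ q + y.map biprod.snd ≫ f
    have hq : y.map biprod.inl ≫ q' = q := by
      simp [q', ← y.map_comp_assoc]
    have hf : y.map biprod.inr ≫ q' = f := by
      simp [q', ← y.map_comp_assoc]
    have hle : imageSubobject q ≤ imageSubobject q' := by
      conv_lhs => rw [← hq]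
      exact imageSubobject_comp_le _ _
    have heq : imageSubobject q = imageSubobject q' :=
      eq_of_le_of_not_lt hle (hmax _ ⟨⟨_, q'⟩, rfl⟩)
    have hinr : (imageSubobject q').Factors (y.map biprod.inr ≫ q') :=
      imageSubobject_factors_comp_self q' _
    rwa [hf, ← heq] at hinr
  refine ⟨P, q, Preadditive.epi_of_cancel_zero q fun {T} g hg => ?_⟩
  have harrow : (imageSubobject q).arrow ≫ g = 0 :=
    imageSubobject_arrow_comp_eq_zero hg
  refine (Preadditive.isSeparating_iff _).mp hX _ fun _ hG f => ?_
  obtain ⟨i⟩ := hG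
  rw [← Subobject.factorThru_arrow _ f (hfac i f), Category.assoc, harrow, comp_zero]

end FinitelyGenerated

section AdditiveYoneda

universe v w

variable {A : Type w} [Category.{v} A] [Preadditive A]

instance : (additiveYoneda : A ⥤ _).Full :=
  inferInstanceAs ((additiveFunctor Aᵒᵖ AddCommGrpCat.{v}).lift preadditiveYoneda _).Full

instance : (additiveYoneda : A ⥤ _).Faithful :=
  inferInstanceAs ((additiveFunctor Aᵒᵖ AddCommGrpCat.{v}).lift preadditiveYoneda _).Faithful

instance : (additiveYoneda : A ⥤ _).Additive where
  map_add {X Y f g} := by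
    ext Z h
    exact Preadditive.comp_add _ _ _ h f g

variable {F G : Aᵒᵖ ⥤+ AddCommGrpCat.{v}} {X : A}

/-- The Yoneda lemma for additive functors. -/
def additiveYonedaEquiv : (additiveYoneda.obj X ⟶ F) ≃ F.obj.obj (op X) where
  toFun τ := (τ.hom.app (op X)).hom (𝟙 X)
  invFun x := ObjectProperty.homMk
    { app Y := AddCommGrpCat.ofHom (AddMonoidHom.mk' (fun f : Y.unop ⟶ X => (F.obj.map f.op).hom x)
        fun f g => congr(($(F.obj.map_add (f := f.op) (g := g.op))).hom x))
      naturality Y Z h := by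
        ext f
        exact congr(($(F.obj.map_comp f.op h)).hom x) }
  left_inv τ := by
    ext Y f
    exact congr(($(τ.hom.naturality f.op)).hom (𝟙 X)).symm.trans
      congr((τ.hom.app Y).hom $(Category.comp_id f))
  right_inv x := congr(($(F.obj.map_id (op X))).hom x)

lemma additiveYonedaEquiv_comp (τ : additiveYoneda.obj X ⟶ F) (φ : F ⟶ G) :
    additiveYonedaEquiv (τ ≫ φ) = (φ.hom.app (op X)).hom (additiveYonedaEquiv τ) :=
  rfl

lemma additiveYonedaEquiv_map_comp {Y : A} (f : Y ⟶ X) (τ : additiveYoneda.obj X ⟶ F) :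
    additiveYonedaEquiv (additiveYoneda.map f ≫ τ) = (τ.hom.app (op Y)).hom f :=
  congr((τ.hom.app (op Y)).hom $(Category.id_comp f))

lemma isZero_obj_iff_forall_eq_zero :
    IsZero (F.obj.obj (op X)) ↔ ∀ τ : additiveYoneda.obj X ⟶ F, τ = 0 := by
  rw [AddCommGrpCat.isZero_iff_subsingleton, ← additiveYonedaEquiv.subsingleton_congr]
  exact subsingleton_iff_forall_eq 0

lemma surjective_app_of_epi (φ : F ⟶ G) [Epi φ] (X : A) :
    Function.Surjective (φ.hom.app (op X)).hom := by
  have : (additiveFunctor Aᵒᵖ AddCommGrpCat.{v}).ι.PreservesEpimorphisms :=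
    ObjectProperty.preservesEpimorphisms_ι_of_isNormalMonoCategory _
  have : Epi φ.hom := (additiveFunctor Aᵒᵖ AddCommGrpCat.{v}).ι.map_epi φ
  exact (AddCommGrpCat.epi_iff_surjective _).mp (inferInstance : Epi (φ.hom.app (op X)))

instance projective_additiveYoneda_obj (X : A) : Projective (additiveYoneda.obj X) where
  factors {F G} τ φ _ := by
    obtain ⟨x, hx⟩ := surjective_app_of_epi φ X (additiveYonedaEquiv τ)
    refine ⟨additiveYonedaEquiv.symm x, additiveYonedaEquiv.injective ?_⟩
    rw [additiveYonedaEquiv_comp, Equiv.apply_symm_apply, hx]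

lemma isZero_obj_of_mono (φ : F ⟶ G) [Mono φ] (hG : IsZero (G.obj.obj (op X))) :
    IsZero (F.obj.obj (op X)) := by
  rw [isZero_obj_iff_forall_eq_zero] at hG ⊢
  exact fun τ => zero_of_comp_mono φ (hG _)

lemma isZero_obj_of_epi (φ : F ⟶ G) [Epi φ] (hF : IsZero (F.obj.obj (op X))) :
    IsZero (G.obj.obj (op X)) := by
  rw [isZero_obj_iff_forall_eq_zero] at hF ⊢
  intro τ
  rw [← Projective.factorThru_comp τ φ, hF (Projective.factorThru τ φ), zero_comp]

lemma isSeparating_additiveYoneda {ι : Type*} {X : ι → A}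
    (hX : ∀ Y : A, ∃ (n : ℕ) (j : Fin n → ι) (a : ∀ t, Y ⟶ X (j t)) (b : ∀ t, X (j t) ⟶ Y),
      𝟙 Y = ∑ t, a t ≫ b t) :
    (ObjectProperty.ofObj fun i => additiveYoneda.obj (X i)).IsSeparating := by
  refine (Preadditive.isSeparating_iff _).mpr fun F G φ hφ => ?_
  have hzero (Y : A) (τ : additiveYoneda.obj Y ⟶ F) : τ ≫ φ = 0 := by
    obtain ⟨n, j, a, b, hab⟩ := hX Y
    rw [← Category.id_comp (τ ≫ φ), ← additiveYoneda.map_id, hab, Functor.map_sum,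
      Preadditive.sum_comp]
    refine Finset.sum_eq_zero fun t _ => ?_
    have ht := hφ _ ⟨j t⟩ (additiveYoneda.map (b t) ≫ τ)
    rw [Functor.map_comp, Category.assoc, ← Category.assoc (additiveYoneda.map (b t)), ht,
      comp_zero]
  ext Y x
  have h := congr(additiveYonedaEquiv $(hzero Y.unop (additiveYonedaEquiv.symm x)))
  rwa [additiveYonedaEquiv_comp, Equiv.apply_symm_apply] at h

theorem isFinPresFunctor_of_isNoetherianObject [HasBinaryBiproducts A] [Nonempty A] {ι : Type*}
    {X : ι → A} (hX : (ObjectProperty.ofObj fun i => additiveYoneda.obj (X i)).IsSeparating)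
    [∀ M : A, IsNoetherianObject (additiveYoneda.obj M)] (F : Aᵒᵖ ⥤+ AddCommGrpCat.{v})
    [IsNoetherianObject F] : IsFinPresFunctor F := by
  obtain ⟨M', p, hp⟩ := exists_epi_of_isNoetherianObject hX F
  have : IsNoetherianObject (kernel p) := isNoetherianObject_of_mono (kernel.ι p)
  obtain ⟨M, q, hq⟩ := exists_epi_of_isNoetherianObject hX (kernel p)
  refine ⟨M, M', q ≫ kernel.ι p, p, by rw [Category.assoc, kernel.condition, comp_zero], ?_, hp⟩
  have hlift : kernel.lift p (q ≫ kernel.ι p) (by simp) = q := by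
    rw [← cancel_mono (kernel.ι p), kernel.lift_ι]
  rwa [ShortComplex.exact_iff_epi_kernel_lift, hlift]

end AdditiveYoneda

section SimpleFunctors

universe v w

variable {A : Type w} [Category.{v} A] [Preadditive A]

lemma comp_eq_zero_iff_mem_radHom {𝒜 : Type*} [Category 𝒜] [Abelian 𝒜] {y : A ⥤ 𝒜} [y.Additive]
    [y.Full] {X Y : A} [IsLocalRing (End X)] [Projective (y.obj X)] {F : 𝒜} [Simple F]
    {q : y.obj X ⟶ F} (hq : q ≠ 0) (f : Y ⟶ X) : y.map f ≫ q = 0 ↔ f ∈ radHom Y X := by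
  have eq_zero_of_isUnit (φ : End X) (hφ : IsUnit φ) (h : y.map φ ≫ q = 0) : q = 0 := by
    have : IsIso φ := (isUnit_iff_isIso φ).mp hφ
    exact zero_of_epi_comp (y.map φ) h
  constructor
  · intro hf g
    refine mem_jacobson_iff_not_isUnit.mpr fun hu => hq (eq_zero_of_isUnit _ hu ?_)
    rw [Functor.map_comp, Category.assoc, hf, comp_zero]
  · intro hf
    by_contra hne
    have : Epi (y.map f ≫ q) := epi_of_nonzero_to_simple hne
    obtain ⟨g, hg⟩ := y.map_surjective (Projective.factorThru q (y.map f ≫ q))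
    refine hq (eq_zero_of_isUnit _ (isUnit_one_sub_of_mem_jacobson (hf g)) ?_)
    have hgf : y.map (g ≫ f) ≫ q = q := by
      rw [Functor.map_comp, Category.assoc, hg, Projective.factorThru_comp]
    change y.map (𝟙 X - g ≫ f) ≫ q = 0
    rw [Functor.map_sub, y.map_id, Preadditive.sub_comp, Category.id_comp, hgf, sub_self]

/-- The canonical projection of `Hom(-, M)` onto `S_M`. -/
def simpleFunctor.π (M : A) : additiveYoneda.obj M ⟶ simpleFunctor M :=
  ObjectProperty.homMk
    { app N := AddCommGrpCat.ofHom
        (AddMonoidHom.mk' (fun f : N.unop ⟶ M => (f : (N.unop ⟶ M) ⧸ radHom _ M)) fun _ _ => rfl) }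

instance (M : A) : Epi (simpleFunctor.π M) := by
  have (N : Aᵒᵖ) : Epi ((simpleFunctor.π M).hom.app N) :=
    (AddCommGrpCat.epi_iff_surjective _).mpr (QuotientAddGroup.mk_surjective)
  have : Epi ((additiveFunctor Aᵒᵖ AddCommGrpCat.{v}).ι.map (simpleFunctor.π M)) :=
    NatTrans.epi_of_epi_app (simpleFunctor.π M).hom
  exact (additiveFunctor Aᵒᵖ AddCommGrpCat.{v}).ι.epi_of_epi_map this

lemma simpleFunctor.map_comp_π_eq_zero_iff {M N : A} (f : N ⟶ M) :
    additiveYoneda.map f ≫ simpleFunctor.π M = 0 ↔ f ∈ radHom N M := by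
  rw [← additiveYonedaEquiv.injective.eq_iff, additiveYonedaEquiv_map_comp]
  exact QuotientAddGroup.eq_zero_iff f

theorem nonempty_iso_simpleFunctor_of_ne_zero {ι : Type*} {X : ι → A}
    (hX : (ObjectProperty.ofObj fun i => additiveYoneda.obj (X i)).IsSeparating)
    {F : Aᵒᵖ ⥤+ AddCommGrpCat.{v}} [Simple F] {M : A} [IsLocalRing (End M)]
    {q : additiveYoneda.obj M ⟶ F} (hq : q ≠ 0) : Nonempty (F ≅ simpleFunctor M) := by
  have : Epi q := epi_of_nonzero_to_simple hq
  refine nonempty_iso_of_forall_comp_eq_zero_iff hX (π := simpleFunctor.π M) (q := q) ?_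
  rintro _ ⟨i⟩ f
  obtain ⟨f, rfl⟩ := additiveYoneda.map_surjective f
  rw [simpleFunctor.map_comp_π_eq_zero_iff, comp_eq_zero_iff_mem_radHom hq]

theorem exists_nonempty_iso_simpleFunctor {ι : Type*} {X : ι → A}
    (hX : (ObjectProperty.ofObj fun i => additiveYoneda.obj (X i)).IsSeparating)
    [∀ i, IsLocalRing (End (X i))] (F : Aᵒᵖ ⥤+ AddCommGrpCat.{v}) [Simple F] :
    ∃ i, ¬ IsZero (F.obj.obj (op (X i))) ∧ Nonempty (F ≅ simpleFunctor (X i)) := by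
  obtain ⟨i, q, hq⟩ : ∃ i, ∃ q : additiveYoneda.obj (X i) ⟶ F, q ≠ 0 := by
    by_contra! hzero
    refine id_nonzero F ((Preadditive.isSeparating_iff _).mp hX _ ?_)
    rintro _ ⟨i⟩ q
    rw [hzero i q, zero_comp]
  exact ⟨i, fun h => hq (isZero_obj_iff_forall_eq_zero.mp h q),
    nonempty_iso_simpleFunctor_of_ne_zero hX hq⟩

end SimpleFunctors

section FiniteCMType

variable {R : Type u} [CommRing R]

theorem IsFiniteCMType.exists_family [IsLocalRing R] (h : IsFiniteCMType R) :
    ∃ (ι : Type (u + 1)) (_ : Finite ι) (X : ι → MCMCat R), (∀ i, Indecomposable (X i).obj) ∧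
      ∀ M, isMCM R M → Indecomposable M → ∃ i, Nonempty (M ≅ (X i).obj) := by
  refine ⟨_, h.to_subtype, fun c => c.2.choose, fun c => c.2.choose_spec.1, fun M hM hi => ?_⟩
  have hc : ∃ N : MCMCat R, Indecomposable N.obj ∧
      Quotient.mk (isIsomorphicSetoid (MCMCat R)) N = Quotient.mk _ ⟨M, hM⟩ :=
    ⟨⟨M, hM⟩, hi, rfl⟩
  obtain ⟨e⟩ := Quotient.exact hc.choose_spec.2
  exact ⟨⟨_, hc⟩, ⟨(isMCM R).ι.mapIso e.symm⟩⟩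

section FiniteLength

variable [IsLocalRing R] [IsNoetherianRing R] {ι : Type*} [Finite ι]
  {X : ι → MCMCat R} {F : MCMFunctor R} {M₁ M₀ : MCMCat R} {γ : M₁ ⟶ M₀}
  {p : additiveYoneda.obj M₀ ⟶ F}

lemma MCMCat.isArtinianObject_of_surjective [Epi p]
    (hX : ∀ N, isMCM R N → Indecomposable N → ∃ i, Nonempty (N ≅ (X i).obj))
    (w : additiveYoneda.map γ ≫ p = 0) (hγ : Function.Surjective γ.hom.hom) :
    IsArtinianObject F := by
  have hart (i : ι) : IsArtinian R ((X i ⟶ M₀) ⧸ factorsSubmodule R p (X i) ⊥) := by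
    refine isArtinian_of_forall_exists_pow_smul_eq_zero fun r hr f => ?_
    obtain ⟨f, rfl⟩ := Submodule.Quotient.mk_surjective _ f
    obtain ⟨n, h, hn⟩ := isMCM.exists_pow_smul_eq_comp hX M₀.property M₁.property (X i).property hγ
      hr f.hom.hom
    have hfγ : r ^ n • f = (ObjectProperty.homMk (ModuleCat.ofHom h) : X i ⟶ M₁) ≫ γ :=
      (MCMCat.homLinearEquiv (X i) M₀).injective ((map_smul _ _ _).trans hn)
    refine ⟨n, ?_⟩
    rw [← Submodule.Quotient.mk_smul, Submodule.Quotient.mk_eq_zero, mem_factorsSubmodule, hfγ,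
      Functor.map_comp, Category.assoc, w, comp_zero]
    exact Subobject.factors_zero
  exact isArtinianObject_of_isArtinian R
    (isSeparating_additiveYoneda (MCMCat.exists_id_eq_sum hX)) p

variable [IsCMLocalRing R]

lemma MCMCat.surjective_of_exact_of_isZero {w : additiveYoneda.map γ ≫ p = 0}
    (hex : (ShortComplex.mk (additiveYoneda.map γ) p w).Exact)
    (hF : IsZero (F.obj.obj (op (MCMCat.self R)))) : Function.Surjective γ.hom.hom := by
  intro x
  let f : MCMCat.self R ⟶ M₀ := ObjectProperty.homMk
    (ModuleCat.ofHom (LinearMap.toSpanSingleton R M₀.obj x))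
  have hf : additiveYoneda.map f ≫ p = 0 := isZero_obj_iff_forall_eq_zero.mp hF _
  obtain ⟨g, hg⟩ := additiveYoneda.map_surjective (hex.liftFromProjective _ hf)
  have hgγ : g ≫ γ = f := additiveYoneda.map_injective <| by
    rw [Functor.map_comp, hg]
    exact hex.liftFromProjective_comp _ hf
  exact ⟨g.hom.hom (1 : R), congr(($hgγ).hom.hom (1 : R)).trans (one_smul R x)⟩

theorem IsFinPresVanishing.isArtinianObject (hF : IsFinPresVanishing F)
    (hX : ∀ N, isMCM R N → Indecomposable N → ∃ i, Nonempty (N ≅ (X i).obj)) :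
    IsArtinianObject F := by
  obtain ⟨⟨M₁, M₀, g, p, w, hex, hp⟩, hR⟩ := hF
  obtain ⟨γ, rfl⟩ := additiveYoneda.map_surjective g
  exact MCMCat.isArtinianObject_of_surjective hX w (MCMCat.surjective_of_exact_of_isZero hex hR)

theorem IsFinPresVanishing.isNoetherianObject (hF : IsFinPresVanishing F)
    (hX : ∀ N, isMCM R N → Indecomposable N → ∃ i, Nonempty (N ≅ (X i).obj)) :
    IsNoetherianObject F := by
  obtain ⟨⟨_, _, _, p, _, _, hp⟩, -⟩ := hF
  exact isNoetherianObject_of_isNoetherian R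
    (isSeparating_additiveYoneda (MCMCat.exists_id_eq_sum hX)) p

theorem IsFinPresVanishing.of_mono (hF : IsFinPresVanishing F)
    (hX : ∀ N, isMCM R N → Indecomposable N → ∃ i, Nonempty (N ≅ (X i).obj)) {G : MCMFunctor R}
    (φ : G ⟶ F) [Mono φ] : IsFinPresVanishing G := by
  have hsep := isSeparating_additiveYoneda (MCMCat.exists_id_eq_sum hX)
  have : Nonempty (MCMCat R) := ⟨MCMCat.self R⟩
  have (M : MCMCat R) : IsNoetherianObject (additiveYoneda.obj M) :=
    isNoetherianObject_of_isNoetherian R hsep (𝟙 _)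
  have := hF.isNoetherianObject hX
  have : IsNoetherianObject G := isNoetherianObject_of_mono φ
  exact ⟨isFinPresFunctor_of_isNoetherianObject hsep G, isZero_obj_of_mono φ hF.2⟩

end FiniteLength

end FiniteCMType

theorem mainTheorem5_general (R : Type u) [CommRing R] [HenselianLocalRing R] [IsNoetherianRing R]
    [IsCMLocalRing R] (hfin : IsFiniteCMType R) (F : MCMFunctor R) (hF : IsFinPresVanishing F) :
    ∃ (n : ℕ) (s : Fin (n + 1) → Subobject F),
      s 0 = ⊥ ∧ s (Fin.last n) = ⊤ ∧
      (∀ i : Fin (n + 1), IsFinPresVanishing (s i : MCMFunctor R)) ∧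
      ∀ i : Fin n, ∃ h : s i.castSucc ≤ s i.succ,
        Simple (cokernel (Subobject.ofLE _ _ h)) ∧
        ∃ M : MCMCat R, Indecomposable M.obj ∧ ¬ Nonempty (M ≅ MCMCat.self R) ∧
          Nonempty (cokernel (Subobject.ofLE _ _ h) ≅ simpleFunctor M) := by
  obtain ⟨ι, _, X, hind, hX⟩ := hfin.exists_family
  have (j : ι) : IsLocalRing (End (X j)) := MCMCat.isLocalRing_end (hind j)
  have := hF.isArtinianObject hX
  have := hF.isNoetherianObject hX
  obtain ⟨a, ha0, n, han, hcov⟩ := exists_covBy_seq_of_wellFoundedLT_wellFoundedGT (Subobject F)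
  refine ⟨n, fun i => a i, ha0.eq_bot, han.eq_top, fun i => hF.of_mono hX (a i).arrow,
    fun i => ?_⟩
  have hcov : a i.castSucc ⋖ a i.succ := hcov i i.2
  have hsimple := simple_cokernel_ofLE_of_covBy hcov
  set Q := cokernel (Subobject.ofLE _ _ hcov.le)
  have hQR : IsZero (Q.obj.obj (op (MCMCat.self R))) :=
    isZero_obj_of_epi (cokernel.π _) (isZero_obj_of_mono (a i.succ).arrow hF.2)
  obtain ⟨j, hQX, hQ⟩ := exists_nonempty_iso_simpleFunctor
    (isSeparating_additiveYoneda (MCMCat.exists_id_eq_sum hX)) Q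
  exact ⟨hcov.le, hsimple, X j, hind j, fun ⟨e⟩ => hQX (hQR.of_iso (Q.obj.mapIso e.symm.op)), hQ⟩

theorem mainTheorem5 (R : Type u) [CommRing R] [HenselianLocalRing R] [IsNoetherianRing R]
    [IsCMLocalRing R] (hcan : HasCanonicalModule R) (hsing : IsIsolatedSingularity R)
    (hfin : IsFiniteCMType R) (F : MCMFunctor R) (hF : IsFinPresVanishing F) :
    ∃ (n : ℕ) (s : Fin (n + 1) → Subobject F),
      s 0 = ⊥ ∧ s (Fin.last n) = ⊤ ∧
      (∀ i : Fin (n + 1), IsFinPresVanishing (s i : MCMFunctor R)) ∧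
      ∀ i : Fin n, ∃ h : s i.castSucc ≤ s i.succ,
        Simple (cokernel (Subobject.ofLE _ _ h)) ∧
        ∃ M : MCMCat R, Indecomposable M.obj ∧ ¬ Nonempty (M ≅ MCMCat.self R) ∧
          Nonempty (cokernel (Subobject.ofLE _ _ h) ≅ simpleFunctor M) :=
  mainTheorem5_general R hfin F hF
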